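/- Let $n\ge 1$, let $\lambda$ be the Lebesgue measure on $\mathbb R^n$, let $\Omega\subset\mathbb R^n$ be a Borel set, and let $\mathrm{ba}_w(\lambda)$ be the set of all bounded, finitely additive set functions $\mu:\mathcal B(\Omega)\to\mathbb R$ on the Borel subsets of $\Omega$ such that $\mu(A)=0$ whenever $\lambda(A)=0$. For $F\subset\mathbb R^n$ and $\delta>0$ put $F_\delta:=\{x\in\mathbb R^n:\operatorname{dist}(x,F)<\delta\}$ (with $F_\delta:=\emptyset$ if $F=\emptyset$). For such $\mu$, a sequence of Borel simple functions $s_k:\Omega\to\mathbb R$ determines the integral of $f:\Omega\to\mathbb R$ if $\inf\{|\mu|(A): A\in\mathcal B(\Omega),\ A\supset\{|s_k-f|>\varepsilon\}\}\to0$ as $k\to\infty$ for every $\varepsilon>0$, and $\int_\Omega|s_k-s_l|\,d|\mu|\to0$ as $k,l\to\infty$; then $f$ is called $\mu$-integrable and $\int_\Omega f\,d\mu:=\lim_{k\to\infty}\int_\Omega s_k\,d\mu$. Here $|\mu|$ is the total variation of $\mu$. The core of $\mu$ is the set of all $x\in\mathbb R^n$ such that $|\mu|(U\cap\Omega)>0$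 for every open $U\ni x$. If the core of $\mu$ is contained in $F$, write $\int_F f\,d\mu$ for the common value of $\int_{F_\delta\cap\Omega}f\,d\mu$, $\delta>0$. Let $F\subset\overline{\Omega}$ be closed with $\lambda(F\cap\Omega)=0$, and let $\nu\in\mathrm{ba}_w(\lambda)$, $\nu\ge0$, be such that $\nu(F_\delta\cap\Omega)>0$ for all $\delta>0$. Then there exists a density measure for $F$, that is, some $\mu\in\mathrm{ba}_w(\lambda)$ with $\mu\ge0$ and $\mu(F_\delta\cap\Omega)=\mu(\Omega)=1$ for all $\delta>0$, such that the core of $\mu$ is contained in $F$ and for every $f\in L^\infty(\Omega,\lambda)$ the function $f$ is integrable over $F_\delta\cap\Omega$ with respect to $\mu$ and $\nu$ for all $\delta>0$, the integral $\int_F f\,d\mu$ is well defined, and $$\liminf_{\delta\downarrow0}\frac1{\nu(F_\delta\cap\Omega)}\int_{F_\delta\cap\Omega}f\,d\nu\ \le\ \int_F f\,d\mu\ \le\ \limsup_{\delta\downarrow0}\frac1{\nu(F_\delta\cap\Omega)}\int_{F_\delta\cap\Omega}f\,d\nu .$$ -/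

import Mathlib

open MeasureTheory Filter Topology Set

noncomputable section

/-- A bounded, finitely additive real-valued set function on the measurable subsets of `X`,
extended by zero to the other subsets. For `X` a Borel subset of `ℝⁿ` the measurable subsets are
the Borel subsets of `X`. -/
structure BoundedCharge (X : Type*) [MeasurableSpace X] where
  toFun : Set X → ℝ
  add' : ∀ A B : Set X, MeasurableSet A → MeasurableSet B → Disjoint A B →
    toFun (A ∪ B) = toFun A + toFun B
  bounded' : ∃ C : ℝ, ∀ A : Set X, MeasurableSet A → |toFun A| ≤ C
  not_measurable' : ∀ A : Set X, ¬ MeasurableSet A → toFun A = 0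

namespace BoundedCharge

variable {X : Type*} [MeasurableSpace X]

instance : CoeFun (BoundedCharge X) (fun _ => Set X → ℝ) := ⟨toFun⟩

/-- `μ ≥ 0`. -/
def Nonneg (μ : BoundedCharge X) : Prop := ∀ A : Set X, MeasurableSet A → 0 ≤ μ A

/-- `μ` vanishes on every measurable null set of the measure `m`, that is, `μ ∈ ba_w(m)`. -/
def WeaklyAC (μ : BoundedCharge X) (m : Measure X) : Prop :=
  ∀ A : Set X, MeasurableSet A → m A = 0 → μ A = 0

/-- The positive part `μ⁺(A) = sup {μ(B) : B ⊆ A measurable}`. -/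
def posPart (μ : BoundedCharge X) (A : Set X) : ℝ :=
  sSup {r : ℝ | ∃ B : Set X, MeasurableSet B ∧ B ⊆ A ∧ r = μ B}

/-- The negative part `μ⁻(A) = sup {-μ(B) : B ⊆ A measurable}`. -/
def negPart (μ : BoundedCharge X) (A : Set X) : ℝ :=
  sSup {r : ℝ | ∃ B : Set X, MeasurableSet B ∧ B ⊆ A ∧ r = -μ B}

/-- The total variation `|μ| = μ⁺ + μ⁻`. -/
def totalVar (μ : BoundedCharge X) (A : Set X) : ℝ := μ.posPart A + μ.negPart A

/-- The outer measure `|μ|*(B) = inf {|μ|(A) : A ⊇ B measurable}` of an arbitrary set. -/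
def outer (μ : BoundedCharge X) (B : Set X) : ℝ :=
  sInf {r : ℝ | ∃ A : Set X, MeasurableSet A ∧ B ⊆ A ∧ r = μ.totalVar A}

/-- `s k → f` in measure with respect to `|μ|`. -/
def ConvInMeasure (μ : BoundedCharge X) (s : ℕ → X → ℝ) (f : X → ℝ) : Prop :=
  ∀ ε : ℝ, 0 < ε → Tendsto (fun k => μ.outer {x | ε < |s k x - f x|}) atTop (𝓝 0)

/-- The integral `∑ y, y * m {s = y}` of a simple function against a set function `m`. -/
def simpleIntegral (m : Set X → ℝ) (s : SimpleFunc X ℝ) : ℝ :=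
  ∑ y ∈ s.range, y * m (s ⁻¹' {y})

/-- `s` is a determining sequence for the integral of `f`: simple functions that converge to `f`
in measure and are Cauchy in the `L¹`-seminorm of `|μ|`. -/
def IsDeterminingSeq (μ : BoundedCharge X) (f : X → ℝ) (s : ℕ → SimpleFunc X ℝ) : Prop :=
  μ.ConvInMeasure (fun k => s k) f ∧
  Tendsto (fun p : ℕ × ℕ => simpleIntegral μ.totalVar ((s p.1 - s p.2).map (fun y => |y|)))
    atTop (𝓝 0)

/-- `f` is integrable with integral `I` with respect to the charge `μ`. -/
def HasIntegral (μ : BoundedCharge X) (f : X → ℝ) (I : ℝ) : Prop :=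
  ∃ s : ℕ → SimpleFunc X ℝ, μ.IsDeterminingSeq f s ∧
    Tendsto (fun k => simpleIntegral μ (s k)) atTop (𝓝 I)

/-- `f` is integrable with respect to the charge `μ`. -/
def Integrable (μ : BoundedCharge X) (f : X → ℝ) : Prop := ∃ I : ℝ, μ.HasIntegral f I

open Classical in
/-- `∫ f dμ`, with value `0` if `f` is not integrable. -/
def integral (μ : BoundedCharge X) (f : X → ℝ) : ℝ :=
  if h : μ.Integrable f then h.choose else 0

/-- `f` is integrable over `A`. -/
def IntegrableOn (μ : BoundedCharge X) (A : Set X) (f : X → ℝ) : Prop :=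
  μ.Integrable (A.indicator f)

/-- `∫_A f dμ`. -/
def setIntegral (μ : BoundedCharge X) (A : Set X) (f : X → ℝ) : ℝ :=
  μ.integral (A.indicator f)

/-- The mean value `(1 / μ(A)) ∫_A f dμ`. -/
def average (μ : BoundedCharge X) (A : Set X) (f : X → ℝ) : ℝ :=
  μ.setIntegral A f / μ A

end BoundedCharge

section Euclidean

variable {n : ℕ}

/-- The Lebesgue measure on the Borel subsets of a Borel set `Ω ⊆ ℝⁿ`. -/
def lebesgueOn (Ω : Set (EuclideanSpace ℝ (Fin n))) : Measure Ω :=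
  (volume : Measure (EuclideanSpace ℝ (Fin n))).comap Subtype.val

/-- `F_δ ∩ Ω` as a subset of `Ω`, where `F_δ = {x : dist(x, F) < δ}`. -/
def nhdIn (Ω F : Set (EuclideanSpace ℝ (Fin n))) (δ : ℝ) : Set Ω :=
  Subtype.val ⁻¹' Metric.thickening δ F

/-- The core of a charge `μ` on `Ω`: the points of `ℝⁿ` all of whose open neighbourhoods `U`
satisfy `|μ|(U ∩ Ω) > 0`. -/
def core {Ω : Set (EuclideanSpace ℝ (Fin n))} (μ : BoundedCharge Ω) :
    Set (EuclideanSpace ℝ (Fin n)) :=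
  {x | ∀ U : Set (EuclideanSpace ℝ (Fin n)), IsOpen U → x ∈ U →
    0 < μ.totalVar (Subtype.val ⁻¹' U)}

/-- `μ` is a density measure for `F`: `μ ∈ ba_w(λ)` with `λ` the Lebesgue measure on `Ω`, `μ ≥ 0`,
and `μ(F_δ ∩ Ω) = μ(Ω) = 1` for all `δ > 0`. -/
structure IsDensityMeasure {Ω : Set (EuclideanSpace ℝ (Fin n))}
    (F : Set (EuclideanSpace ℝ (Fin n))) (μ : BoundedCharge Ω) : Prop where
  weaklyAC : μ.WeaklyAC (lebesgueOn Ω)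
  nonneg : μ.Nonneg
  nhd_eq : ∀ δ : ℝ, 0 < δ → μ (nhdIn Ω F δ) = μ univ
  univ_eq : μ univ = 1

/-- The integral `∫_F f dμ` of a charge `μ` with core in `F` is defined and equal to `I`:
`f` is integrable over `F_δ ∩ Ω` with integral `I`, for every `δ > 0`. -/
structure HasIntegralAlong {Ω : Set (EuclideanSpace ℝ (Fin n))}
    (F : Set (EuclideanSpace ℝ (Fin n))) (μ : BoundedCharge Ω) (f : Ω → ℝ) (I : ℝ) : Prop where
  core_subset : core μ ⊆ F
  integrableOn : ∀ δ : ℝ, 0 < δ → μ.IntegrableOn (nhdIn Ω F δ) f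
  setIntegral_eq : ∀ δ : ℝ, 0 < δ → μ.setIntegral (nhdIn Ω F δ) f = I

end Euclidean

end

/-! Averages of `ν` over shrinking neighbourhoods of `F` need not converge, but an ultrafilter `U`
finer than `𝓝[>] 0` forces convergence: put `μ(A) = lim_U ν(A ∩ F_δ) / ν(F_δ)`. The quotients lie in
the compact interval `[0, 1]`, and additivity and the vanishing on null sets survive the limit
(`exists_conditional_limit`). All mass sits in each `F_δ`, since `F_r ⊆ F_δ` for small `r`. For a
simple function, the `ν`-averages over `F_δ` tend along `U` to its `μ`-integral, by definition of
`μ`. Off a null set `f ∈ L^∞` is a uniform limit of simple functions, with an error in the averages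
independent of `δ` (`hasIntegral_of_uniform_approx`), so the averages of `f` tend along `U` to `∫ f
dμ`. A limit along a finer filter lies between liminf and limsup. -/

namespace BoundedCharge

variable {X : Type*} [MeasurableSpace X] {μ : BoundedCharge X}

/-! ### Nonnegative charges and their outer measures. -/

theorem empty (μ : BoundedCharge X) : μ ∅ = 0 := by
  have h := μ.add' ∅ ∅ .empty .empty (disjoint_empty _)
  rw [union_empty] at h
  linarith

theorem Nonneg.mono (hμ : μ.Nonneg) {A B : Set X} (hA : MeasurableSet A) (hB : MeasurableSet B)
    (h : A ⊆ B) : μ A ≤ μ B := by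
  have h1 := μ.add' A (B \ A) hA (hB.diff hA) disjoint_sdiff_right
  rw [union_sdiff_cancel h] at h1
  linarith [hμ _ (hB.diff hA)]

theorem Nonneg.union_le (hμ : μ.Nonneg) {A B : Set X} (hA : MeasurableSet A)
    (hB : MeasurableSet B) : μ (A ∪ B) ≤ μ A + μ B := by
  have h1 := μ.add' A (B \ A) hA (hB.diff hA) disjoint_sdiff_right
  rw [union_sdiff_self] at h1
  linarith [hμ.mono (hB.diff hA) hB sdiff_subset]

theorem Nonneg.totalVar_eq (hμ : μ.Nonneg) {A : Set X} (hA : MeasurableSet A) :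
    μ.totalVar A = μ A := by
  have h1 : μ.posPart A = μ A := by
    refine IsGreatest.csSup_eq ⟨⟨A, hA, Subset.rfl, rfl⟩, ?_⟩
    rintro r ⟨B, hB, hBA, rfl⟩
    exact hμ.mono hB hA hBA
  have h2 : μ.negPart A = 0 := by
    refine IsGreatest.csSup_eq ⟨⟨∅, .empty, empty_subset _, by simp [μ.empty]⟩, ?_⟩
    rintro r ⟨B, hB, hBA, rfl⟩
    linarith [hμ B hB]
  rw [totalVar, h1, h2, add_zero]

theorem Nonneg.outer_nonneg (hμ : μ.Nonneg) (B : Set X) : 0 ≤ μ.outer B := by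
  refine Real.sInf_nonneg ?_
  rintro r ⟨A, hA, -, rfl⟩
  rw [hμ.totalVar_eq hA]
  exact hμ A hA

theorem Nonneg.outer_le (hμ : μ.Nonneg) {A B : Set X} (hA : MeasurableSet A) (h : B ⊆ A) :
    μ.outer B ≤ μ A := by
  refine csInf_le ⟨0, ?_⟩ ⟨A, hA, h, (hμ.totalVar_eq hA).symm⟩
  rintro r ⟨A, hA, -, rfl⟩
  rw [hμ.totalVar_eq hA]
  exact hμ A hA

theorem Nonneg.exists_measurable_superset (hμ : μ.Nonneg) {B : Set X} {c : ℝ}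
    (h : μ.outer B < c) : ∃ A, MeasurableSet A ∧ B ⊆ A ∧ μ A < c := by
  obtain ⟨r, ⟨A, hA, hBA, rfl⟩, hr⟩ := exists_lt_of_csInf_lt (s := {r : ℝ | ∃ A : Set X,
    MeasurableSet A ∧ B ⊆ A ∧ r = μ.totalVar A}) ⟨_, univ, .univ, subset_univ _, rfl⟩ h
  exact ⟨A, hA, hBA, by rwa [hμ.totalVar_eq hA] at hr⟩

/-! ### Integrals of simple functions. -/

/-- The operator-valued set function `A ↦ (y ↦ μ(A) y)`. -/
noncomputable def toCLM (μ : BoundedCharge X) (A : Set X) : ℝ →L[ℝ] ℝ := μ A • ContinuousLinearMap.id ℝ ℝ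

/-- Gives access to the `setToSimpleFunc` calculus. Over the zero measure every set has finite
measure and every simple function is integrable, so no side conditions remain. -/
theorem finMeasAdditive_toCLM (μ : BoundedCharge X) :
    FinMeasAdditive (0 : Measure X) μ.toCLM := by
  intro s t hs ht _ _ hst
  simp only [toCLM, μ.add' s t hs ht hst, add_smul]

theorem simpleIntegral_eq_setToSimpleFunc (μ : BoundedCharge X) (s : SimpleFunc X ℝ) :
    simpleIntegral μ s = s.setToSimpleFunc μ.toCLM := by
  simp [simpleIntegral, SimpleFunc.setToSimpleFunc, toCLM, mul_comm]

theorem simpleIntegral_add (μ : BoundedCharge X) (s t : SimpleFunc X ℝ) :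
    simpleIntegral μ (s + t) = simpleIntegral μ s + simpleIntegral μ t := by
  simp only [simpleIntegral_eq_setToSimpleFunc]
  exact SimpleFunc.setToSimpleFunc_add _ μ.finMeasAdditive_toCLM integrable_zero_measure
    integrable_zero_measure

theorem simpleIntegral_sub (μ : BoundedCharge X) (s t : SimpleFunc X ℝ) :
    simpleIntegral μ (s - t) = simpleIntegral μ s - simpleIntegral μ t := by
  simp only [simpleIntegral_eq_setToSimpleFunc]
  exact SimpleFunc.setToSimpleFunc_sub _ μ.finMeasAdditive_toCLM integrable_zero_measure
    integrable_zero_measure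

theorem Nonneg.simpleIntegral_mono (hμ : μ.Nonneg) {s t : SimpleFunc X ℝ}
    (h : ∀ x, s x ≤ t x) : simpleIntegral μ s ≤ simpleIntegral μ t := by
  simp only [simpleIntegral_eq_setToSimpleFunc]
  refine SimpleFunc.setToSimpleFunc_mono μ.finMeasAdditive_toCLM (fun A hA _ x hx => ?_)
    integrable_zero_measure integrable_zero_measure h
  simpa [toCLM] using mul_nonneg (hμ A hA) hx

/-- The simple function with value `c` on `A` and `0` elsewhere. -/
noncomputable def indicatorConst (A : Set X) (hA : MeasurableSet A) (c : ℝ) : SimpleFunc X ℝ :=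
  SimpleFunc.piecewise A hA (SimpleFunc.const X c) (SimpleFunc.const X 0)

open Classical in
theorem indicatorConst_apply (A : Set X) (hA : MeasurableSet A) (c : ℝ) (x : X) :
    indicatorConst A hA c x = if x ∈ A then c else 0 := by
  simp [indicatorConst, piecewise]

theorem simpleIntegral_indicatorConst (μ : BoundedCharge X) (A : Set X) (hA : MeasurableSet A)
    (c : ℝ) : simpleIntegral μ (indicatorConst A hA c) = c * μ A := by
  rw [simpleIntegral_eq_setToSimpleFunc, indicatorConst,
    SimpleFunc.setToSimpleFunc_indicator _ (by simp [toCLM, μ.empty])]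
  simp [toCLM, mul_comm]

theorem Nonneg.abs_simpleIntegral_le (hμ : μ.Nonneg) {s t : SimpleFunc X ℝ}
    (h : ∀ x, |s x| ≤ t x) : |simpleIntegral μ s| ≤ simpleIntegral μ t := by
  have h0 := μ.simpleIntegral_sub (indicatorConst univ .univ 0) s
  rw [simpleIntegral_indicatorConst, zero_mul, zero_sub] at h0
  refine abs_le'.2 ⟨hμ.simpleIntegral_mono fun x => (le_abs_self _).trans (h x), ?_⟩
  rw [← h0]
  refine hμ.simpleIntegral_mono fun x => ?_
  have := (neg_le_abs (s x)).trans (h x)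
  simpa [indicatorConst_apply] using this

theorem Nonneg.simpleIntegral_totalVar (hμ : μ.Nonneg) (s : SimpleFunc X ℝ) :
    simpleIntegral μ.totalVar s = simpleIntegral μ s := by
  refine Finset.sum_congr rfl fun y _ => ?_
  rw [hμ.totalVar_eq (s.measurableSet_fiber y)]

/-- The sum runs over the range of `s`, whatever `A` is, so that limits in `A` can be taken term by
term. -/
theorem simpleIntegral_restrict (μ : BoundedCharge X) (s : SimpleFunc X ℝ) {A : Set X}
    (hA : MeasurableSet A) :
    simpleIntegral μ (s.restrict A) = ∑ y ∈ s.range, y * μ (s ⁻¹' {y} ∩ A) := by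
  classical
  rw [simpleIntegral_eq_setToSimpleFunc,
    SimpleFunc.setToSimpleFunc_eq_sum_of_subset (s := s.range) _ (by simp [toCLM, μ.empty])]
  · refine Finset.sum_congr rfl fun y _ => ?_
    rcases eq_or_ne y 0 with rfl | hy
    · simp
    · rw [SimpleFunc.restrict_preimage_singleton _ hA hy, inter_comm]
      simp [toCLM, mul_comm]
  · intro y hy
    rw [Finset.mem_filter, SimpleFunc.mem_restrict_range hA] at hy
    rcases hy with ⟨⟨h, -⟩ | h, h0⟩
    · exact absurd h h0
    · obtain ⟨x, -, rfl⟩ := h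
      exact s.mem_range_self x

/-! ### Uniqueness and existence of the integral. -/

/-- Two determining sequences of a function have the same limit of integrals. -/
theorem Nonneg.hasIntegral_unique (hμ : μ.Nonneg) {f : X → ℝ} {I J : ℝ}
    (hI : μ.HasIntegral f I) (hJ : μ.HasIntegral f J) : I = J := by
  obtain ⟨s, ⟨hs, hs'⟩, hsI⟩ := hI
  obtain ⟨t, ⟨ht, ht'⟩, htJ⟩ := hJ
  simp only [hμ.simpleIntegral_totalVar] at hs' ht'
  have hM : 0 ≤ μ univ := hμ _ .univ
  refine eq_of_abs_sub_le_all fun ε hε => ?_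
  -- The Cauchy terms cost at most `η`, the exceptional set another `η`, and the rest `η * μ univ`;
  -- the constant `3` leaves slack.
  obtain ⟨η, hη, hηε⟩ : ∃ η > 0, η * (3 + μ univ) ≤ ε :=
    ⟨ε / (3 + μ univ), by positivity, (div_mul_cancel₀ _ (by positivity)).le⟩
  rw [← prod_atTop_atTop_eq] at hs' ht'
  -- `N` is fixed before `k`: the bound `C` on `s N - t N` then controls `s k - t k` on the
  -- exceptional set up to `L¹`-small Cauchy terms, although `s k - t k` may be unbounded in `k`.
  obtain ⟨N, hN⟩ := (((hs'.eventually_lt_const (u := η / 2) (by positivity)).and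
    (ht'.eventually_lt_const (u := η / 2) (by positivity))).curry).exists
  obtain ⟨C, hC⟩ : ∃ C : ℝ, ∀ x, |(s N - t N) x| ≤ C := by
    obtain ⟨C, hC⟩ := (s N - t N).exists_forall_norm_le
    exact ⟨C, hC⟩
  have hC' : ∀ x, |(s N - t N) x| ≤ |C| := fun x => (hC x).trans (le_abs_self C)
  have hδ : 0 < η / (2 * (|C| + 1)) := by positivity
  have hk : ∀ᶠ k in atTop, |simpleIntegral μ (s k) - simpleIntegral μ (t k)| ≤ ε := by
    filter_upwards [hN, (hs (η / 2) (by positivity)).eventually_lt_const hδ,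
      (ht (η / 2) (by positivity)).eventually_lt_const hδ] with k hk hsk htk
    obtain ⟨A, hA, hsA, hAδ⟩ := hμ.exists_measurable_superset hsk
    obtain ⟨B, hB, htB, hBδ⟩ := hμ.exists_measurable_superset htk
    have key : |simpleIntegral μ (s k - t k)| ≤
        simpleIntegral μ ((s N - s k).map (fun y => |y|) + (t N - t k).map (fun y => |y|) +
          indicatorConst (A ∪ B) (hA.union hB) |C| + indicatorConst univ .univ η) := by
      refine hμ.abs_simpleIntegral_le fun x => ?_
      simp only [SimpleFunc.coe_add, Pi.add_apply, SimpleFunc.map_apply, SimpleFunc.coe_sub,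
        Pi.sub_apply, indicatorConst_apply, mem_univ, if_true]
      have hc := hC' x
      simp only [SimpleFunc.coe_sub, Pi.sub_apply] at hc
      split_ifs with hx
      · have e : s k x - t k x = (s N x - t N x) - (s N x - s k x) + (t N x - t k x) := by ring
        rw [e]
        linarith [abs_add_le ((s N x - t N x) - (s N x - s k x)) (t N x - t k x),
          abs_sub (s N x - t N x) (s N x - s k x)]
      · have h1 : |s k x - f x| ≤ η / 2 := not_lt.1 fun h => hx (.inl (hsA h))
        have h2 : |t k x - f x| ≤ η / 2 := not_lt.1 fun h => hx (.inr (htB h))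
        have e : s k x - t k x = (s k x - f x) - (t k x - f x) := by ring
        rw [e]
        linarith [abs_sub (s k x - f x) (t k x - f x), abs_nonneg (s N x - s k x),
          abs_nonneg (t N x - t k x)]
    simp only [simpleIntegral_add, simpleIntegral_indicatorConst] at key
    have hAB := hμ.union_le hA hB
    have h3 : |C| * μ (A ∪ B) ≤ |C| * (η / (|C| + 1)) := by
      refine mul_le_mul_of_nonneg_left ?_ (abs_nonneg C)
      have : η / (|C| + 1) = η / (2 * (|C| + 1)) + η / (2 * (|C| + 1)) := by
        field_simp
        ring
      linarith
    have h4 : |C| * (η / (|C| + 1)) ≤ η := by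
      rw [mul_div_assoc', div_le_iff₀ (by positivity)]
      nlinarith [abs_nonneg C]
    rw [← simpleIntegral_sub]
    linarith [hk.1, hk.2]
  exact le_of_tendsto (hsI.sub htJ).abs hk

theorem Nonneg.integral_eq (hμ : μ.Nonneg) {f : X → ℝ} {I : ℝ} (hI : μ.HasIntegral f I) :
    μ.integral f = I := by
  have h : μ.Integrable f := ⟨I, hI⟩
  rw [integral, dif_pos h]
  exact hμ.hasIntegral_unique h.choose_spec hI

/-- A function that vanishes off `A` and is, off a null set, the uniform limit of simple functions
vanishing off `A`, is integrable. -/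
theorem Nonneg.hasIntegral_of_uniform_approx (hμ : μ.Nonneg) {f : X → ℝ}
    {s : ℕ → SimpleFunc X ℝ} {ε : ℕ → ℝ} (hε : Tendsto ε atTop (𝓝 0)) {N A : Set X}
    (hN : MeasurableSet N) (hN0 : μ N = 0) (hA : MeasurableSet A)
    (h : ∀ k, ∀ x ∉ N, |s k x - f x| ≤ A.indicator (fun _ => ε k) x) :
    ∃ I, μ.HasIntegral f I ∧ Tendsto (fun k => simpleIntegral μ (s k)) atTop (𝓝 I) ∧
      ∀ k, |simpleIntegral μ (s k) - I| ≤ ε k * μ A := by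
  have habs : ∀ k l, simpleIntegral μ ((s k - s l).map (fun y => |y|)) ≤
      (ε k + ε l) * μ A := by
    intro k l
    obtain ⟨C, hC⟩ := (s k - s l).exists_forall_norm_le
    have hC' : ∀ x, |s k x - s l x| ≤ |C| := fun x => (hC x).trans (le_abs_self C)
    -- The bound `|C|` on `N` depends on `k` and `l`, but costs nothing because `μ N = 0`.
    have := hμ.simpleIntegral_mono (s := (s k - s l).map (fun y => |y|))
      (t := indicatorConst N hN |C| + indicatorConst (A \ N) (hA.diff hN) (ε k + ε l)) ?_
    · have h1 := μ.add' (A \ N) (A ∩ N) (hA.diff hN) (hA.inter hN)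
        (disjoint_sdiff_left.mono_right inter_subset_right)
      rw [sdiff_union_inter] at h1
      have h2 := hμ.mono (hA.inter hN) hN inter_subset_right
      have h3 := hμ _ (hA.inter hN)
      have h4 : μ (A \ N) = μ A := by linarith
      rwa [simpleIntegral_add, simpleIntegral_indicatorConst, simpleIntegral_indicatorConst, hN0,
        mul_zero, zero_add, h4] at this
    · intro x
      simp only [SimpleFunc.coe_add, Pi.add_apply, SimpleFunc.map_apply, SimpleFunc.coe_sub,
        Pi.sub_apply, indicatorConst_apply, Set.mem_sdiff]
      by_cases hx : x ∈ N
      · simpa [hx] using hC' x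
      · have h1 := h k x hx
        have h2 := h l x hx
        have e : s k x - s l x = (s k x - f x) - (s l x - f x) := by ring
        have h3 := abs_sub (s k x - f x) (s l x - f x)
        rw [← e] at h3
        by_cases hxA : x ∈ A
        · rw [indicator_of_mem hxA] at h1 h2
          rw [if_neg hx, if_pos ⟨hxA, hx⟩]
          linarith
        · rw [indicator_of_notMem hxA] at h1 h2
          rw [if_neg hx, if_neg fun h => hxA h.1]
          linarith
  have hdiff : ∀ k l, |simpleIntegral μ (s k) - simpleIntegral μ (s l)| ≤ (ε k + ε l) * μ A := by
    intro k l
    rw [← simpleIntegral_sub]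
    exact (hμ.abs_simpleIntegral_le fun x => by simp).trans (habs k l)
  have hlim : Tendsto (fun p : ℕ × ℕ => (ε p.1 + ε p.2) * μ A) atTop (𝓝 0) := by
    rw [← prod_atTop_atTop_eq]
    simpa using ((hε.comp tendsto_fst).add (hε.comp tendsto_snd)).mul_const (μ A)
  have hcauchy : CauchySeq fun k => simpleIntegral μ (s k) := by
    rw [cauchySeq_iff_tendsto_dist_atTop_0]
    exact squeeze_zero (fun _ => dist_nonneg) (fun p => hdiff p.1 p.2) hlim
  obtain ⟨I, hI⟩ := cauchySeq_tendsto_of_complete hcauchy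
  refine ⟨I, ⟨s, ⟨fun η hη => ?_, ?_⟩, hI⟩, hI, fun k => ?_⟩
  -- Once `ε k < η`, the exceptional set lies in `N`, so its outer measure is exactly `0`.
  · refine tendsto_const_nhds.congr' ?_
    filter_upwards [hε.eventually_lt_const hη] with k hk
    refine le_antisymm (hμ.outer_nonneg _) (hN0 ▸ hμ.outer_le hN fun x hx => ?_)
    by_contra hxN
    have h1 := h k x hxN
    have h2 : A.indicator (fun _ => ε k) x ≤ max (ε k) 0 := by
      by_cases hxA : x ∈ A <;> simp [hxA]
    exact absurd (h1.trans h2) (not_le.2 ((max_lt hk hη).trans hx))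
  · simp only [hμ.simpleIntegral_totalVar]
    refine squeeze_zero (fun p => ?_) (fun p => habs p.1 p.2) hlim
    exact (abs_nonneg _).trans (hμ.abs_simpleIntegral_le (s := s p.1 - s p.2) fun x => by simp)
  · have h1 := le_of_tendsto_of_tendsto' ((hI.const_sub (simpleIntegral μ (s k))).abs)
      ((hε.const_add (ε k)).mul_const (μ A)) fun l => hdiff k l
    simpa using h1

end BoundedCharge

/-! ### Uniform approximation of essentially bounded functions. -/

/-- Rounding down to multiples of `1 / (k + 1)` approximates a bounded measurable function uniformly
by simple functions. -/
theorem exists_simpleFunc_uniform_approx {X : Type*} [MeasurableSpace X] {g : X → ℝ}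
    (hg : Measurable g) {M : ℝ} (hM : ∀ x, |g x| ≤ M) (k : ℕ) :
    ∃ s : SimpleFunc X ℝ, ∀ x, |s x - g x| ≤ 1 / ((k : ℝ) + 1) := by
  have hk : (0 : ℝ) < (k : ℝ) + 1 := by positivity
  have hm : Measurable fun x => ((⌊((k : ℝ) + 1) * g x⌋ : ℤ) : ℝ) / ((k : ℝ) + 1) :=
    (measurable_from_top.comp (Int.measurable_floor.comp (hg.const_mul _))).div_const _
  refine ⟨⟨_, fun y => hm (measurableSet_singleton y), ?_⟩, fun x => ?_⟩
  · refine ((finite_Icc ⌊-(((k : ℝ) + 1) * M)⌋ ⌊((k : ℝ) + 1) * M⌋).image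
      fun z : ℤ => (z : ℝ) / ((k : ℝ) + 1)).subset ?_
    rintro _ ⟨x, rfl⟩
    obtain ⟨h1, h2⟩ := abs_le.1 (hM x)
    exact ⟨_, ⟨Int.floor_le_floor (by nlinarith), Int.floor_le_floor (by nlinarith)⟩, rfl⟩
  · change |((⌊((k : ℝ) + 1) * g x⌋ : ℤ) : ℝ) / ((k : ℝ) + 1) - g x| ≤ _
    have h1 := Int.floor_le (((k : ℝ) + 1) * g x)
    have h2 := Int.lt_floor_add_one (((k : ℝ) + 1) * g x)
    rw [div_sub' hk.ne', abs_div, abs_of_pos hk]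
    refine div_le_div_of_nonneg_right (abs_le.2 ⟨?_, ?_⟩) hk.le <;> linarith

/-- An essentially bounded function is, off a measurable null set, a uniform limit of simple
functions. -/
theorem MeasureTheory.MemLp.exists_simpleFunc_uniform_approx {X : Type*} [MeasurableSpace X]
    {m : Measure X} {f : X → ℝ} (hf : MemLp f ⊤ m) :
    ∃ (s : ℕ → SimpleFunc X ℝ) (N : Set X), MeasurableSet N ∧ m N = 0 ∧
      ∀ k, ∀ x ∉ N, |s k x - f x| ≤ 1 / ((k : ℝ) + 1) := by
  obtain ⟨g, hg, hfg⟩ := hf.1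
  obtain ⟨C, hC⟩ : ∃ C : ℝ, ∀ᵐ x ∂m, |f x| ≤ C := by
    refine ⟨(eLpNorm f ⊤ m).toReal, ?_⟩
    have h := ae_le_eLpNormEssSup (f := f) (μ := m)
    rw [← eLpNorm_exponent_top] at h
    filter_upwards [h] with x hx
    simpa using ENNReal.toReal_mono hf.2.ne hx
  -- Clipping makes the measurable representative bounded everywhere and changes nothing where it
  -- equals `f` and `|f| ≤ C`.
  have hclip : ∀ x, |max (-|C|) (min |C| (g x))| ≤ |C| := fun x =>
    abs_le.2 ⟨le_max_left _ _, max_le (by linarith [abs_nonneg C]) (min_le_left _ _)⟩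
  choose s hs using fun k => _root_.exists_simpleFunc_uniform_approx
    (measurable_const.max (measurable_const.min hg.measurable) :
      Measurable fun x => max (-|C|) (min |C| (g x))) hclip k
  obtain ⟨N, hN, hNm, hN0⟩ := exists_measurable_superset_of_null (hfg.and hC)
  refine ⟨s, N, hNm, hN0, fun k x hx => ?_⟩
  obtain ⟨h1, h2⟩ := not_not.1 fun h => hx (hN h)
  have h3 := hs k x
  obtain ⟨h4, h5⟩ := abs_le.1 (h2.trans (le_abs_self C))
  rwa [← h1, min_eq_right h5, max_eq_right h4] at h3

/-! ### The limit charge. -/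

namespace BoundedCharge

variable {X : Type*} [MeasurableSpace X]

/-- The limits along an ultrafilter of the conditional charges `A ↦ ν(A ∩ B_i) / ν(B_i)` form a
nonnegative charge. -/
theorem Nonneg.exists_conditional_limit {ν : BoundedCharge X} (hν : ν.Nonneg) {ι : Type*}
    (U : Ultrafilter ι) {B : ι → Set X} (hB : ∀ i, MeasurableSet (B i)) :
    ∃ μ : BoundedCharge X, μ.Nonneg ∧
      ∀ A, MeasurableSet A → Tendsto (fun i => ν (A ∩ B i) / ν (B i)) U (𝓝 (μ A)) := by
  classical
  -- If `ν (B i) = 0`, the quotient is `0` by convention, so the bounds hold for every `i`.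
  have hmem : ∀ A, MeasurableSet A → ∀ i, ν (A ∩ B i) / ν (B i) ∈ Icc (0 : ℝ) 1 := fun A hA i =>
    ⟨div_nonneg (hν _ (hA.inter (hB i))) (hν _ (hB i)),
      div_le_one_of_le₀ (hν.mono (hA.inter (hB i)) (hB i) inter_subset_right) (hν _ (hB i))⟩
  have hlim : ∀ A, ∃ L : ℝ, MeasurableSet A → L ∈ Icc (0 : ℝ) 1 ∧
      Tendsto (fun i => ν (A ∩ B i) / ν (B i)) U (𝓝 L) := by
    intro A
    by_cases hA : MeasurableSet A
    · obtain ⟨L, hL, hUL⟩ := isCompact_Icc.ultrafilter_le_nhds'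
        (U.map fun i => ν (A ∩ B i) / ν (B i))
        (Ultrafilter.mem_map.2 (univ_mem' (hmem A hA)))
      exact ⟨L, fun _ => ⟨hL, hUL⟩⟩
    · exact ⟨0, fun h => absurd h hA⟩
  choose L hL using hlim
  refine ⟨⟨fun A => if MeasurableSet A then L A else 0, fun A A' hA hA' hd => ?_,
    ⟨1, fun A hA => ?_⟩, fun A hA => if_neg hA⟩, fun A hA => ?_, fun A hA => ?_⟩
  · rw [if_pos hA, if_pos hA', if_pos (hA.union hA')]
    refine tendsto_nhds_unique (hL _ (hA.union hA')).2 (((hL _ hA).2.add (hL _ hA').2).congr ?_)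
    intro i
    rw [union_inter_distrib_right, ν.add' _ _ (hA.inter (hB i)) (hA'.inter (hB i))
      (hd.mono inter_subset_left inter_subset_left), add_div]
  · rw [if_pos hA, abs_of_nonneg (hL A hA).1.1]
    exact (hL A hA).1.2
  · change 0 ≤ if MeasurableSet A then L A else 0
    rw [if_pos hA]
    exact (hL A hA).1.1
  · change Tendsto _ _ (𝓝 (if MeasurableSet A then L A else 0))
    rw [if_pos hA]
    exact (hL A hA).2

end BoundedCharge

/-! ### The density measure. -/

theorem measurableSet_nhdIn {n : ℕ} (Ω F : Set (EuclideanSpace ℝ (Fin n))) (δ : ℝ) :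
    MeasurableSet (nhdIn Ω F δ) :=
  measurable_subtype_coe Metric.isOpen_thickening.measurableSet

open BoundedCharge in
theorem mainTheorem3 (n : ℕ) (Ω F : Set (EuclideanSpace ℝ (Fin n)))
    (hΩ : MeasurableSet Ω) (hF : IsClosed F) (hFΩ : F ⊆ closure Ω)
    (hnull : volume (F ∩ Ω) = 0)
    (ν : BoundedCharge Ω) (hνac : ν.WeaklyAC (lebesgueOn Ω)) (hν : ν.Nonneg)
    (hνF : ∀ δ : ℝ, 0 < δ → 0 < ν (nhdIn Ω F δ)) :
    ∃ μ : BoundedCharge Ω, IsDensityMeasure F μ ∧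
      ∀ f : Ω → ℝ, MemLp f ⊤ (lebesgueOn Ω) →
        (∀ δ : ℝ, 0 < δ → ν.IntegrableOn (nhdIn Ω F δ) f) ∧
        ∃ I : ℝ, HasIntegralAlong F μ f I ∧
          liminf (fun δ : ℝ => (ν.average (nhdIn Ω F δ) f : EReal)) (𝓝[>] 0) ≤ (I : EReal) ∧
          (I : EReal) ≤ limsup (fun δ : ℝ => (ν.average (nhdIn Ω F δ) f : EReal)) (𝓝[>] 0) := by
  have hmeas := measurableSet_nhdIn Ω F
  set U : Ultrafilter ℝ := Ultrafilter.of (𝓝[>] 0)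
  have hU : (U : Filter ℝ) ≤ 𝓝[>] 0 := Ultrafilter.of_le _
  have hU0 : ∀ᶠ δ in (U : Filter ℝ), 0 < δ := hU self_mem_nhdsWithin
  obtain ⟨μ, hμ, hlim⟩ := hν.exists_conditional_limit U hmeas
  have hone : ∀ A, MeasurableSet A → ∀ δ > 0, nhdIn Ω F δ ⊆ A → μ A = 1 := by
    intro A hA δ hδ hsub
    refine tendsto_nhds_unique (hlim A hA) (tendsto_const_nhds.congr' ?_)
    filter_upwards [hU0, hU (Ioo_mem_nhdsGT hδ)] with r hr hrδ
    rw [inter_eq_self_of_subset_right, div_self (hνF r hr).ne']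
    exact (preimage_mono (Metric.thickening_mono hrδ.2.le F)).trans hsub
  have huniv : μ univ = 1 := hone univ .univ 1 one_pos (subset_univ _)
  have hcompl : ∀ δ > 0, μ (nhdIn Ω F δ)ᶜ = 0 := by
    intro δ hδ
    have h := μ.add' _ _ (hmeas δ) (hmeas δ).compl disjoint_compl_right
    rw [union_compl_self, huniv, hone _ (hmeas δ) δ hδ Subset.rfl] at h
    linarith
  have hμac : μ.WeaklyAC (lebesgueOn Ω) := by
    intro A hA h0
    refine tendsto_nhds_unique (hlim A hA) (tendsto_const_nhds.congr fun δ => ?_)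
    rw [hνac _ (hA.inter (hmeas δ)) (measure_mono_null inter_subset_left h0), zero_div]
  have hcore : core μ ⊆ F := by
    intro x hx
    by_contra hxF
    obtain ⟨r, hr, hball⟩ := Metric.isOpen_iff.1 hF.isOpen_compl x hxF
    -- With half the radius, a point of the ball within `r / 2` of `F` would put a point of `F` in
    -- `ball x r`; so this ball misses `F_{r/2}`.
    have h := hx (Metric.ball x (r / 2)) Metric.isOpen_ball (Metric.mem_ball_self (by positivity))
    have hm : MeasurableSet (Subtype.val ⁻¹' Metric.ball x (r / 2) : Set Ω) :=
      measurable_subtype_coe Metric.isOpen_ball.measurableSet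
    rw [hμ.totalVar_eq hm] at h
    refine h.not_ge ((hμ.mono hm (hmeas (r / 2)).compl fun y hy hyF => ?_).trans
      (hcompl (r / 2) (by positivity)).le)
    obtain ⟨z, hz, hyz⟩ := Metric.mem_thickening_iff.1 hyF
    refine hball (Metric.mem_ball.2 ?_) hz
    have hy' : dist (y : EuclideanSpace ℝ (Fin n)) x < r / 2 := hy
    linarith [dist_triangle_left z x (y : EuclideanSpace ℝ (Fin n))]
  refine ⟨μ, ⟨hμac, hμ, fun δ hδ => ?_, huniv⟩, fun f hf => ?_⟩
  · rw [huniv, hone _ (hmeas δ) δ hδ Subset.rfl]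
  obtain ⟨s, N, hN, hN0, hs⟩ := hf.exists_simpleFunc_uniform_approx
  have hε : Tendsto (fun k : ℕ => 1 / ((k : ℝ) + 1)) atTop (𝓝 0) :=
    tendsto_one_div_add_atTop_nhds_zero_nat
  -- Restricting the simple functions to `F_δ` makes the error proportional to `ν(F_δ)`; in the
  -- average this factor cancels, leaving a bound uniform in `δ`.
  have hν' : ∀ δ, ∃ I, ν.HasIntegral ((nhdIn Ω F δ).indicator f) I ∧ ∀ k : ℕ,
      |simpleIntegral ν ((s k).restrict (nhdIn Ω F δ)) - I| ≤
        1 / ((k : ℝ) + 1) * ν (nhdIn Ω F δ) := by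
    intro δ
    obtain ⟨I, h1, -, h2⟩ := hν.hasIntegral_of_uniform_approx
      (f := (nhdIn Ω F δ).indicator f) (s := fun k => (s k).restrict (nhdIn Ω F δ)) hε hN
      (hνac N hN hN0) (hmeas δ) fun k x hx => by
        rw [SimpleFunc.restrict_apply _ (hmeas δ)]
        by_cases hxA : x ∈ nhdIn Ω F δ <;> simp only [hxA, indicator_of_mem,
          indicator_of_notMem, not_false_eq_true, sub_self, abs_zero, le_refl]
        exact hs k x hx
    exact ⟨I, h1, h2⟩
  -- For `μ` the complement of `F_δ` joins the null set, so the same unrestricted `s k` serve every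
  -- `δ`, and the integral does not depend on `δ`.
  have hμ' : ∀ δ > 0, ∃ I, μ.HasIntegral ((nhdIn Ω F δ).indicator f) I ∧
      Tendsto (fun k => simpleIntegral μ (s k)) atTop (𝓝 I) ∧
      ∀ k : ℕ, |simpleIntegral μ (s k) - I| ≤ 1 / ((k : ℝ) + 1) * μ univ := by
    intro δ hδ
    have hNc : μ (N ∪ (nhdIn Ω F δ)ᶜ) = 0 := by
      refine le_antisymm ?_ (hμ _ (hN.union (hmeas δ).compl))
      exact (hμ.union_le hN (hmeas δ).compl).trans (by rw [hμac N hN hN0, hcompl δ hδ, add_zero])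
    refine hμ.hasIntegral_of_uniform_approx hε (hN.union (hmeas δ).compl) hNc .univ
      fun k x hx => ?_
    rw [mem_union, mem_compl_iff, not_or, not_not] at hx
    rw [indicator_of_mem hx.2, indicator_of_mem (mem_univ x)]
    exact hs k x hx.1
  refine ⟨fun δ _ => ⟨_, (hν' δ).choose_spec.1⟩, ?_⟩
  obtain ⟨I, -, hI, hIk⟩ := hμ' 1 one_pos
  have hμI : ∀ δ > 0, μ.HasIntegral ((nhdIn Ω F δ).indicator f) I := by
    intro δ hδ
    obtain ⟨J, h1, h2, -⟩ := hμ' δ hδ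
    rwa [tendsto_nhds_unique hI h2]
  have hsimple : ∀ k, Tendsto (fun δ => simpleIntegral ν ((s k).restrict (nhdIn Ω F δ)) /
      ν (nhdIn Ω F δ)) U (𝓝 (simpleIntegral μ (s k))) := by
    intro k
    simp only [simpleIntegral_restrict _ _ (hmeas _), Finset.sum_div, mul_div_assoc]
    exact tendsto_finsetSum _ fun y _ =>
      (hlim _ ((s k).measurableSet_fiber y)).const_mul y
  have havg : Tendsto (fun δ => ν.average (nhdIn Ω F δ) f) U (𝓝 I) := by
    rw [Metric.tendsto_nhds]
    intro ε hε0
    obtain ⟨k, hk⟩ := (hε.eventually_lt_const (u := ε / 3) (by positivity)).exists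
    filter_upwards [hU0, Metric.tendsto_nhds.1 (hsimple k) (ε / 3) (by positivity)] with δ hδ h1
    obtain ⟨J, hJ, hJk⟩ := hν' δ
    have h2 := hIk k
    have h3 : |simpleIntegral ν ((s k).restrict (nhdIn Ω F δ)) / ν (nhdIn Ω F δ) -
        ν.average (nhdIn Ω F δ) f| ≤ 1 / ((k : ℝ) + 1) := by
      rw [BoundedCharge.average, setIntegral, hν.integral_eq hJ, ← sub_div, abs_div, abs_of_pos (hνF δ hδ),
        div_le_iff₀ (hνF δ hδ)]
      exact hJk k
    rw [huniv, mul_one] at h2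
    rw [Real.dist_eq] at h1 ⊢
    rw [abs_lt] at h1 ⊢
    rw [abs_le] at h2 h3
    constructor <;> linarith [h1.1, h1.2, h2.1, h2.2, h3.1, h3.2]
  -- In the complete lattice `EReal`, comparing liminf and limsup along `U` and `𝓝[>] 0` needs no
  -- boundedness of the averages.
  have havg' : Tendsto (fun δ => (ν.average (nhdIn Ω F δ) f : EReal)) U (𝓝 (I : EReal)) :=
    (continuous_coe_real_ereal.tendsto I).comp havg
  refine ⟨I, ⟨hcore, fun δ hδ => ⟨I, hμI δ hδ⟩, fun δ hδ => hμ.integral_eq (hμI δ hδ)⟩, ?_, ?_⟩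
  · exact (liminf_le_liminf_of_le hU).trans_eq havg'.liminf_eq
  · exact havg'.limsup_eq.symm.trans_le (limsup_le_limsup_of_le hU)
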